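/- For $\sigma\in S_n$ (permutations of $\{1,\dots,n\}$) let $A(\sigma)=\{(\sigma(i),\sigma(i+1)):1\le i\le n-1\}$ and let $d_B(\sigma,\tau)=|A(\sigma)\setminus A(\tau)|$ be the block permutation distance. A set $C\subseteq S_N$ has distance $d$ if $d_B(\pi,\pi')\ge d$ for all distinct $\pi,\pi'\in C$. It is systematic over $S_n$ ($n\le N$) if for every $\sigma\in S_n$ there is exactly one $\pi\in C$ such that deleting the symbols $n+1,\dots,N$ from the word $(\pi(1),\dots,\pi(N))$ leaves $(\sigma(1),\dots,\sigma(n))$. For $\sigma\in S_n$ and $S=(s_1,\dots,s_K)\in\{1,\dots,n\}^K$ let $E(\sigma,S)\in S_{n+K}$ be obtained from the word of $\sigma$ by inserting successively, for $m=1,\dots,K$, the symbol $n+m$ directly after the symbol $s_m$. Let $N\ge 37$, $d\ge 4$, $N\ge 9d+1$, and put $K=3d-1$, $n=N-K=N-3d+1$. Then there are explicit systematic block permutation codes in $S_N$ with distance $d$ and size $(N-3d+1)!$, namely the following ones. Consider any prime $p$ with $n\le p<2n$, any distinct $\alpha_1,\dots,\alpha_n\in\mathbb F_p$, any irreducible $f\in\mathbb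 F_p[x]$ of degree $d-1$, and any map $s:S_n\to\{1,\dots,n\}$ that is injective on each left coset of $\langle\omega\rangle$, where $\omega=(1\,2\cdots n)$; such choices exist. Let $G=(\mathbb F_p[x]/(f^2))^\times$ and $$\nabla(\sigma)=\Big(\Big[\prod_{i=1}^n (x-\alpha_{\sigma(i)})^{\sigma(i+1)}\Big],\,s(\sigma)\Big)\in G/G^p\times\{1,\dots,n\},\qquad \sigma(n+1):=\sigma(1).$$ For $\beta\in\mathbb F_p^{K}$ let $A_\beta$ be the set of all words in $\{1,\dots,n\}^K$ with pairwise distinct entries which, after identifying $1,\dots,n$ with the residues of $0,\dots,n-1$ in $\mathbb F_p$, lie in the translate by $\beta$ of the Reed–Solomon code $\{(g(0),g(1),\dots,g(K-1)): g\in\mathbb F_p[x],\ \deg g<2d\}$. Then there are $\beta$ and an injection $\psi: G/G^p\times\{1,\dots,n\}\to A_\beta$; and for every $\beta$ and every such injection $\psi$ the set $$\{E(\sigma,\psi(\nabla(\sigma))):\sigma\in S_n\}\subseteq S_N$$ is systematic over $S_n$, has distance $d$, and has exactly $(N-3d+1)!$ elements. -/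

import Mathlib

open Polynomial

namespace BlockPerm

/-! ### Block permutation distance, codes, systematic codes

The symmetric group `S_n` is `Equiv.Perm (Fin n)`; the symbols are `0, …, n - 1`
instead of `1, …, n`. -/

/-- The characteristic set `A(σ) = {(σ(i), σ(i+1)) : i is not the last index}`. -/
def charSet {n : ℕ} (σ : Equiv.Perm (Fin n)) : Finset (Fin n × Fin n) :=
  Finset.univ.filter fun x => ∃ i j : Fin n, i.val + 1 = j.val ∧ σ i = x.1 ∧ σ j = x.2

/-- The block permutation distance `d_B(σ, τ) = |A(σ) \ A(τ)|`. -/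
def blockDist {n : ℕ} (σ τ : Equiv.Perm (Fin n)) : ℕ :=
  (charSet σ \ charSet τ).card

/-- Any two distinct codewords have block permutation distance at least `d`. -/
def HasDistance {N : ℕ} (C : Set (Equiv.Perm (Fin N))) (d : ℕ) : Prop :=
  ∀ σ ∈ C, ∀ τ ∈ C, σ ≠ τ → d ≤ blockDist σ τ

/-- The word `(σ(0), σ(1), …, σ(n-1))` of a permutation. -/
def word {n : ℕ} (σ : Equiv.Perm (Fin n)) : List ℕ :=
  List.ofFn fun i => (σ i).val

/-- `C ⊆ S_N` is systematic with information permutations `S_n`: every `σ ∈ S_n` is obtained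
from exactly one codeword by deleting the redundant symbols `n, …, N - 1` from its word. -/
def IsSystematic {N : ℕ} (n : ℕ) (C : Set (Equiv.Perm (Fin N))) : Prop :=
  n ≤ N ∧ ∀ σ : Equiv.Perm (Fin n), ∃! π, π ∈ C ∧ (word π).filter (fun x => x < n) = word σ

/-! ### Extended permutations -/

/-- Insert the symbol `new` directly after the symbol `s` in the word `w`. -/
def insertAfter (w : List ℕ) (s new : ℕ) : List ℕ :=
  w.flatMap fun x => if x = s then [x, new] else [x]

/-- The word of the extension `E(σ, S)` of `σ ∈ S_n`: the new symbols `n, n + 1, …, n + K - 1` are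
inserted one after the other, each directly after the corresponding entry of `S`. -/
def extend {n K : ℕ} (σ : Equiv.Perm (Fin n)) (S : Fin K → Fin n) : List ℕ :=
  (List.finRange K).foldl (fun w m => insertAfter w (S m).val (n + m.val)) (word σ)

/-! ### The labelling of permutations -/

/-- The choices that enter the labelling of `S_n`: a prime `p ∈ [n, 2n)`, distinct
`α_0, …, α_{n-1} ∈ 𝔽_p`, an irreducible `f ∈ 𝔽_p[x]` of degree `d - 1`, and a numbering `s` of the
elements of the left cosets of `⟨ω⟩`, where `ω` is the cycle `i ↦ i + 1`. -/
structure LabelData (n d : ℕ) where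
  four_le : 4 ≤ d
  p : ℕ
  prime : p.Prime
  n_le : n ≤ p
  p_lt : p < 2 * n
  α : Fin n → ZMod p
  α_injective : Function.Injective α
  f : (ZMod p)[X]
  f_irreducible : Irreducible f
  f_degree : f.natDegree = d - 1
  s : Equiv.Perm (Fin n) → Fin n
  s_separates : ∀ σ τ : Equiv.Perm (Fin n),
    (QuotientGroup.mk σ : Equiv.Perm (Fin n) ⧸ Subgroup.zpowers (finRotate n)) =
      QuotientGroup.mk τ → s σ = s τ → σ = τ

namespace LabelData

variable {n d : ℕ} (L : LabelData n d)

/-- The ring `𝔽_p[x] / (f²)`. -/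
abbrev R : Type := (ZMod L.p)[X] ⧸ Ideal.span {L.f ^ 2}

/-- The group `G / G^p`, where `G` is the group of units of `𝔽_p[x] / (f²)`. -/
abbrev GModPow : Type := L.Rˣ ⧸ (powMonoidHom (α := L.Rˣ) L.p).range

/-- Labels are pairs in `G / G^p × ℤ_n`. -/
abbrev Label : Type := L.GModPow × Fin n

theorem isUnit_linear (a : ZMod L.p) :
    IsUnit (Ideal.Quotient.mk (Ideal.span {L.f ^ 2}) (X - C a)) := by
  have := Fact.mk L.prime
  have h4 := L.four_le
  have hco : IsCoprime (X - C a) L.f := by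
    rw [(irreducible_X_sub_C a).coprime_iff_not_dvd]
    intro hdvd
    obtain ⟨g, hg⟩ := hdvd
    have hX := irreducible_X_sub_C a
    have hu := (L.f_irreducible.isUnit_or_isUnit hg).resolve_left hX.not_isUnit
    have hdeg := congrArg natDegree hg
    rw [natDegree_mul hX.ne_zero hu.ne_zero, natDegree_X_sub_C,
      natDegree_eq_zero_of_isUnit hu, L.f_degree] at hdeg
    omega
  obtain ⟨u, v, huv⟩ := hco.pow_right (n := 2)
  refine IsUnit.of_mul_eq_one (Ideal.Quotient.mk _ u) ?_
  have hz : Ideal.Quotient.mk (Ideal.span {L.f ^ 2}) (L.f ^ 2) = 0 :=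
    Ideal.Quotient.eq_zero_iff_mem.2 (Ideal.mem_span_singleton_self _)
  have := congrArg (Ideal.Quotient.mk (Ideal.span {L.f ^ 2})) huv
  rw [map_add, map_mul, map_mul, hz, mul_zero, add_zero, map_one] at this
  rw [mul_comm]; exact this

/-- The residue class of `x - a` in `G`. -/
noncomputable def linearUnit (a : ZMod L.p) : L.Rˣ := (L.isUnit_linear a).unit

/-- The class of `∏_i (x - α_{σ(i)}) ^ σ(i+1)` in `G / G^p`, where `i` runs cyclically over all
indices and the exponent is the symbol `σ(i+1)` counted from `1`. -/
noncomputable def cyclicClass (σ : Equiv.Perm (Fin n)) : L.GModPow :=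
  QuotientGroup.mk
    (∏ i : Fin n, L.linearUnit (L.α (σ i)) ^ ((σ (finRotate n i)).val + 1))

/-- The label of `σ`. -/
noncomputable def label (σ : Equiv.Perm (Fin n)) : L.Label := (L.cyclicClass σ, L.s σ)

/-- The set of the extensions `E(σ, ψ(label σ))`, `σ ∈ S_n`, as a subset of `S_N`. -/
def code (N : ℕ) {K : ℕ} (ψ : L.Label → Fin K → Fin n) : Set (Equiv.Perm (Fin N)) :=
  {π | ∃ σ : Equiv.Perm (Fin n), word π = extend σ (ψ (L.label σ))}

end LabelData

/-- The words of length `3d - 1` with pairwise distinct entries in `{0, …, n - 1} ⊆ 𝔽_p` in the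
translate by `β` of the Reed-Solomon code of length `3d - 1` and dimension `2d` over `𝔽_p`
(evaluation at `0, 1, …, 3d - 2` of the polynomials of degree less than `2d`). -/
def rsWords (n d p : ℕ) (β : Fin (3 * d - 1) → ZMod p) : Set (Fin (3 * d - 1) → Fin n) :=
  {S | Function.Injective S ∧ ∃ g : (ZMod p)[X], g.degree < ((2 * d : ℕ) : WithBot ℕ) ∧
    ∀ m, ((S m).val : ZMod p) = g.eval (m.val : ZMod p) + β m}

end BlockPerm

open BlockPerm

namespace BlockPerm

/-! Two codewords are compared through the labels of their information permutations. If the labels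
differ, the insertion words S and T are distinct elements of one translate of a Reed–Solomon code,
so they differ in at least d positions; at each such position m the pair (S m, n + m) occurs in the
first codeword only (`card_ne_le_blockDist`).

If the labels agree, so do the insertions. Let D be the set of symbols whose cyclic successors under
σ and τ differ. Equal classes in G/G^p mean P H^p ≡ Q mod f² for the two products P, Q of linear
factors. Since (H^p)' = 0, the logarithmic derivatives of P and Q agree mod f. Hence f divides
Σ_{a∈D} c_a ∏_{b∈D, b≠a} (x - α_b), where c_a is the difference of the successors of a. For nonempty
D this is a nonzero polynomial, of degree at most |D| - 2 because Σ c_a = 0, so |D| ≥ d + 1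
(`card_cyclicSucc_ne`). Passing from cyclic to linear words costs at most one pair. If D is empty, σ
and τ lie in one left coset of ⟨ω⟩, where s tells them apart.

The injection ψ exists by counting: |G/G^p| ≤ p^(d-1) (`card_gModPow_le`), and averaging over all
translates gives a β with at least n p^(d-1) admissible words (`exists_card_rsWords_ge`,
`mul_pow_le_descFactorial`). -/

/-! ### Adjacent symbols and insertions -/

/-- The symbol `b` follows the symbol `a` somewhere in the word. -/
def Follows : List ℕ → ℕ → ℕ → Prop
  | [], _, _ => False
  | x :: l, a, b => (a = x ∧ l.head? = some b) ∨ Follows l a b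

theorem follows_iff_getElem? (l : List ℕ) (a b : ℕ) :
    Follows l a b ↔ ∃ i : ℕ, l[i]? = some a ∧ l[i + 1]? = some b := by
  induction l with
  | nil => simp [Follows]
  | cons x l ih =>
    rw [Follows, ih]
    constructor
    · rintro (⟨rfl, h⟩ | ⟨i, h⟩)
      · exact ⟨0, by simpa [List.head?_eq_getElem?] using h⟩
      · exact ⟨i + 1, by simpa using h⟩
    · rintro ⟨i, h⟩
      cases i with
      | zero => left; simpa [List.head?_eq_getElem?, eq_comm] using h
      | succ i => right; exact ⟨i, by simpa using h⟩

theorem Follows.mem {l : List ℕ} {a b : ℕ} (h : Follows l a b) : a ∈ l ∧ b ∈ l := by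
  obtain ⟨i, h1, h2⟩ := (follows_iff_getElem? l a b).1 h
  exact ⟨List.mem_of_getElem? h1, List.mem_of_getElem? h2⟩

theorem insertAfter_cons (x : ℕ) (w : List ℕ) (s new : ℕ) :
    insertAfter (x :: w) s new =
      if x = s then x :: new :: insertAfter w s new else x :: insertAfter w s new := by
  by_cases h : x = s <;> simp [insertAfter, h]

theorem insertAfter_head? (w : List ℕ) (s new : ℕ) :
    (insertAfter w s new).head? = w.head? := by
  cases w with
  | nil => rfl
  | cons x w => rw [insertAfter_cons]; split_ifs <;> rfl

theorem insertAfter_of_notMem {w : List ℕ} {s : ℕ} (new : ℕ) (h : s ∉ w) :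
    insertAfter w s new = w := by
  induction w with
  | nil => rfl
  | cons x w ih =>
    simp only [List.mem_cons, not_or] at h
    rw [insertAfter_cons, if_neg (Ne.symm h.1), ih h.2]

theorem insertAfter_perm {w : List ℕ} {s : ℕ} (new : ℕ) (hw : w.Nodup) (h : s ∈ w) :
    (insertAfter w s new).Perm (new :: w) := by
  induction w with
  | nil => simp at h
  | cons x w ih =>
    rw [List.nodup_cons] at hw
    rw [insertAfter_cons]
    split_ifs with hx
    · subst hx
      rw [insertAfter_of_notMem new hw.1]
      exact List.Perm.swap _ _ _
    · have h' : s ∈ w := (List.mem_cons.1 h).resolve_left (Ne.symm hx)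
      exact ((ih hw.2 h').cons x).trans (List.Perm.swap _ _ _)

theorem filter_insertAfter (w : List ℕ) (s : ℕ) {new n : ℕ} (h : n ≤ new) :
    (insertAfter w s new).filter (fun x => x < n) = w.filter (fun x => x < n) := by
  induction w with
  | nil => rfl
  | cons x w ih =>
    rw [insertAfter_cons]
    split_ifs <;> simp [List.filter_cons, ih, h]

theorem follows_insertAfter {w : List ℕ} {s new : ℕ} (hs : s ≠ new) (hnew : new ∉ w) (a b : ℕ) :
    Follows (insertAfter w s new) a b ↔
      (a = s ∧ b = new ∧ s ∈ w) ∨ (a = new ∧ Follows w s b) ∨ (a ≠ s ∧ Follows w a b) := by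
  induction w with
  | nil => simp [insertAfter, Follows]
  | cons x w ih =>
    simp only [List.mem_cons, not_or] at hnew
    have hmem : Follows w new b → new ∈ w := fun h => h.mem.1
    rw [insertAfter_cons]
    split_ifs with hx
    · simp only [Follows, ih hnew.2, insertAfter_head?, List.head?_cons, List.mem_cons,
        Option.some_inj]
      grind
    · simp only [Follows, ih hnew.2, insertAfter_head?, List.mem_cons]
      grind

section Insertions

variable {n K : ℕ} (S : Fin K → Fin n) (w : List ℕ)

/-- The insertions of the symbols `n + m`, where `m` runs through a list. -/
def insertAll (ms : List (Fin K)) : List ℕ :=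
  ms.foldl (fun w m => insertAfter w (S m).val (n + m.val)) w

theorem insertAll_concat (ms : List (Fin K)) (m : Fin K) :
    insertAll S w (ms ++ [m]) = insertAfter (insertAll S w ms) (S m).val (n + m.val) := by
  simp [insertAll]

variable {w}

theorem insertAll_perm (hw : w.Perm (List.range n)) (ms : List (Fin K)) (hms : ms.Nodup) :
    (insertAll S w ms).Perm (ms.map (fun m => n + m.val) ++ List.range n) := by
  induction ms using List.reverseRecOn with
  | nil => simpa [insertAll] using hw
  | append_singleton ms m ih =>
    have hms' := List.nodup_append.1 hms
    have ih := ih hms'.1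
    rw [insertAll_concat]
    have hnd : (ms.map (fun m : Fin K => n + m.val) ++ List.range n).Nodup := by
      refine List.Nodup.append (hms'.1.map ?_) List.nodup_range ?_
      · intro a b h; ext; simpa using h
      · intro x hx hx'
        simp only [List.mem_map, List.mem_range] at hx hx'
        obtain ⟨a, -, rfl⟩ := hx
        omega
    refine (insertAfter_perm _ (ih.nodup_iff.2 hnd) ?_).trans ?_
    · rw [ih.mem_iff]; simp
    · refine (ih.cons _).trans ?_
      rw [List.map_append, List.append_assoc]
      exact List.perm_middle.symm

theorem mem_insertAll (hw : w.Perm (List.range n)) (ms : List (Fin K)) (hms : ms.Nodup) (x : ℕ) :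
    x ∈ insertAll S w ms ↔ x < n ∨ ∃ m ∈ ms, x = n + m.val := by
  rw [(insertAll_perm S hw ms hms).mem_iff]
  simp [or_comm, eq_comm]

/-- The insertions do not interact: by injectivity no symbol of `w` receives two of them, and no
inserted symbol is itself an insertion point. Each one only splits a pair (s, b) of `w` into (s, n +
m) and (n + m, b). -/
theorem follows_insertAll (hS : Function.Injective S) (hw : w.Perm (List.range n))
    (ms : List (Fin K)) (hms : ms.Nodup) (a b : ℕ) :
    Follows (insertAll S w ms) a b ↔
      (∃ m ∈ ms, a = (S m).val ∧ b = n + m.val) ∨ (∃ m ∈ ms, a = n + m.val ∧ Follows w (S m) b) ∨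
        ((∀ m ∈ ms, a ≠ (S m).val) ∧ Follows w a b) := by
  induction ms using List.reverseRecOn generalizing a b with
  | nil => simp [insertAll]
  | append_singleton ms k ih =>
    have hms' := List.nodup_append.1 hms
    have hk : k ∉ ms := fun h => hms'.2.2 k h k (by simp) rfl
    have hlt : ∀ m, (S m).val < n := fun m => (S m).isLt
    have hinj : ∀ m, (S k).val = (S m).val → m = k := fun m h => (hS (Fin.ext h)).symm
    rw [insertAll_concat, follows_insertAfter (by have := hlt k; omega)]
    · have hmem : (S k).val ∈ insertAll S w ms := by
        rw [mem_insertAll S hw ms hms'.1]; exact Or.inl (hlt k)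
      have h1 : Follows (insertAll S w ms) (S k).val b ↔ Follows w (S k).val b := by
        rw [ih hms'.1]
        constructor
        · rintro (⟨m, hm, h, -⟩ | ⟨m, hm, h, -⟩ | ⟨-, h⟩)
          · exact absurd (hinj m h ▸ hm) hk
          · have := hlt k; omega
          · exact h
        · intro h
          exact Or.inr (Or.inr ⟨fun m hm h' => hk (hinj m h' ▸ hm), h⟩)
      rw [h1, ih hms'.1]
      simp only [List.mem_append, List.mem_singleton, or_imp, forall_and, forall_eq, or_and_right,
        exists_or, exists_eq_left]
      constructor
      · rintro (⟨h1, h2, -⟩ | h | ⟨h1, h | h | h⟩)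
        · exact Or.inl (Or.inr ⟨h1, h2⟩)
        · exact Or.inr (Or.inl (Or.inr h))
        · exact Or.inl (Or.inl h)
        · exact Or.inr (Or.inl (Or.inl h))
        · exact Or.inr (Or.inr ⟨⟨h.1, h1⟩, h.2⟩)
      · rintro ((⟨m, hm, h1, h2⟩ | h) | (⟨m, hm, h1, h2⟩ | h) | h)
        · refine Or.inr (Or.inr ⟨fun h => hk ?_, Or.inl ⟨m, hm, h1, h2⟩⟩)
          exact hinj m (h ▸ h1) ▸ hm
        · tauto
        · refine Or.inr (Or.inr ⟨fun h => ?_, Or.inr (Or.inl ⟨m, hm, h1, h2⟩)⟩)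
          have := hlt k; omega
        · tauto
        · tauto
    · rw [mem_insertAll S hw ms hms'.1]
      rintro (h | ⟨m, hm, h⟩)
      · omega
      · exact hk ((Fin.ext (by omega) : k = m) ▸ hm)

end Insertions

/-! ### Words of permutations and of their extensions -/

theorem word_perm {n : ℕ} (σ : Equiv.Perm (Fin n)) : (word σ).Perm (List.range n) := by
  refine (List.perm_ext_iff_of_nodup ?_ List.nodup_range).2 fun x => ?_
  · exact List.nodup_ofFn.2 fun i j h => σ.injective (Fin.ext h)
  · simp only [word, List.mem_ofFn, List.mem_range]
    constructor
    · rintro ⟨i, rfl⟩; exact (σ i).isLt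
    · intro h; exact ⟨σ.symm ⟨x, h⟩, by simp⟩

theorem word_injective {n : ℕ} : Function.Injective (word (n := n)) := by
  intro σ τ h
  have := List.ofFn_injective h
  ext i
  exact congrFun this i

theorem exists_word_eq {N : ℕ} {l : List ℕ} (h : l.Perm (List.range N)) :
    ∃ π : Equiv.Perm (Fin N), word π = l := by
  have hlen : l.length = N := by simpa using h.length_eq
  have hlt : ∀ i : Fin N, l[i.val]'(by omega) < N := fun i =>
    List.mem_range.1 (h.mem_iff.1 (List.getElem_mem _))
  have hnd : l.Nodup := h.nodup_iff.2 List.nodup_range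
  let g : Fin N → Fin N := fun i => ⟨l[i.val]'(by omega), hlt i⟩
  have hg : Function.Injective g := by
    intro i j hij
    exact Fin.ext ((hnd.getElem_inj_iff).1 (Fin.mk.inj_iff.1 hij))
  refine ⟨Equiv.ofBijective g (Finite.injective_iff_bijective.1 hg), ?_⟩
  refine List.ext_getElem (by simp [word, hlen]) fun i h1 h2 => ?_
  simp [word, g]

theorem extend_perm {n K : ℕ} (σ : Equiv.Perm (Fin n)) (S : Fin K → Fin n) :
    (extend σ S).Perm (List.range (n + K)) := by
  refine (insertAll_perm S (word_perm σ) _ (List.nodup_finRange K)).trans ?_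
  refine List.perm_append_comm.trans ?_
  rw [List.range_add]
  refine List.Perm.append_left _ (List.Perm.of_eq ?_)
  refine List.ext_getElem (by simp) fun i h1 h2 => by simp

theorem filter_extend {n K : ℕ} (σ : Equiv.Perm (Fin n)) (S : Fin K → Fin n) :
    (extend σ S).filter (fun x => x < n) = word σ := by
  have key : ∀ ms : List (Fin K), (insertAll S (word σ) ms).filter (fun x => x < n) = word σ := by
    intro ms
    induction ms using List.reverseRecOn with
    | nil =>
      refine List.filter_eq_self.2 fun x hx => ?_
      simpa using (word_perm σ).mem_iff.1 hx
    | append_singleton ms m ih =>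
      rw [insertAll_concat, filter_insertAfter _ _ (by omega), ih]
  exact key _

theorem follows_extend {n K : ℕ} (σ : Equiv.Perm (Fin n)) {S : Fin K → Fin n}
    (hS : Function.Injective S) (a b : ℕ) :
    Follows (extend σ S) a b ↔
      (∃ m, a = (S m).val ∧ b = n + m.val) ∨ (∃ m, a = n + m.val ∧ Follows (word σ) (S m) b) ∨
        ((∀ m, a ≠ (S m).val) ∧ Follows (word σ) a b) := by
  change Follows (insertAll S (word σ) (List.finRange K)) a b ↔ _
  simpa using follows_insertAll S hS (word_perm σ) _ (List.nodup_finRange K) a b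

theorem follows_word {n : ℕ} (σ : Equiv.Perm (Fin n)) (a b : Fin n) :
    Follows (word σ) a b ↔ ∃ i j : Fin n, i.val + 1 = j.val ∧ σ i = a ∧ σ j = b := by
  rw [follows_iff_getElem?]
  simp only [word, List.getElem?_ofFn]
  constructor
  · rintro ⟨i, h1, h2⟩
    by_cases hi : i + 1 < n
    · rw [dif_pos (by omega)] at h1
      rw [dif_pos hi] at h2
      exact ⟨⟨i, by omega⟩, ⟨i + 1, hi⟩, rfl, Fin.ext (by simpa using h1),
        Fin.ext (by simpa using h2)⟩
    · rw [dif_neg hi] at h2; simp at h2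
  · rintro ⟨i, j, h, rfl, rfl⟩
    refine ⟨i, by simp, ?_⟩
    rw [dif_pos (by omega)]
    simp [h]

theorem mem_charSet {n : ℕ} (σ : Equiv.Perm (Fin n)) (a b : Fin n) :
    (a, b) ∈ charSet σ ↔ Follows (word σ) a b := by
  rw [follows_word]; simp [charSet]

/-! ### Cyclic successors and cosets of the rotation -/

section Cyclic

theorem finRotate_pow_zero (n : ℕ) (j : Fin (n + 1)) :
    (finRotate (n + 1) ^ j.val) 0 = j := by
  have key : ∀ k : ℕ, k ≤ n → ((finRotate (n + 1) ^ k) 0).val = k := by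
    intro k
    induction k with
    | zero => simp
    | succ k ih =>
      intro hk
      have ih := ih (by omega)
      rw [pow_succ', Equiv.Perm.mul_apply, coe_finRotate_of_ne_last, ih]
      intro h
      rw [h, Fin.val_last] at ih
      omega
  exact Fin.ext (key _ (by omega))

theorem eq_one_of_commute_finRotate {n : ℕ} {g : Equiv.Perm (Fin (n + 1))}
    (hg : Commute g (finRotate (n + 1))) (h0 : g 0 = 0) : g = 1 := by
  ext j
  rw [← finRotate_pow_zero n j, ← Equiv.Perm.mul_apply, (hg.pow_right j.val).eq,
    Equiv.Perm.mul_apply, h0]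
  rfl

/-- The powers of the rotation act transitively, so a suitable one moves `g 0` back to 0; a
permutation that commutes with the rotation and fixes 0 is trivial. -/
theorem mem_zpowers_of_commute_finRotate {n : ℕ} {g : Equiv.Perm (Fin (n + 1))}
    (hg : Commute g (finRotate (n + 1))) : g ∈ Subgroup.zpowers (finRotate (n + 1)) := by
  have h := eq_one_of_commute_finRotate (g := (finRotate (n + 1) ^ (g 0).val)⁻¹ * g)
    (((Commute.refl _).pow_left _).inv_left.mul_left hg) (by
      rw [Equiv.Perm.mul_apply, Equiv.Perm.inv_eq_iff_eq, finRotate_pow_zero])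
  rw [inv_mul_eq_one] at h
  rw [← h]
  exact pow_mem (Subgroup.mem_zpowers _) _

/-- The cyclic successor map `σ(i) ↦ σ(i + 1)` of a permutation. -/
def cyclicSucc {n : ℕ} (σ : Equiv.Perm (Fin n)) : Equiv.Perm (Fin n) :=
  σ * finRotate n * σ⁻¹

theorem cyclicSucc_apply {n : ℕ} (σ : Equiv.Perm (Fin n)) (i : Fin n) :
    cyclicSucc σ (σ i) = σ (finRotate n i) := by
  simp [cyclicSucc]

theorem mk_eq_of_cyclicSucc_eq {n : ℕ} {σ τ : Equiv.Perm (Fin (n + 1))}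
    (h : cyclicSucc σ = cyclicSucc τ) :
    (QuotientGroup.mk σ : Equiv.Perm (Fin (n + 1)) ⧸ Subgroup.zpowers (finRotate (n + 1))) =
      QuotientGroup.mk τ := by
  rw [QuotientGroup.eq]
  apply mem_zpowers_of_commute_finRotate
  unfold cyclicSucc at h
  change _ * _ = _ * _
  rw [mul_inv_eq_iff_eq_mul] at h
  calc σ⁻¹ * τ * finRotate (n + 1) = σ⁻¹ * (τ * finRotate (n + 1) * τ⁻¹ * σ) * (σ⁻¹ * τ) := by group
    _ = finRotate (n + 1) * (σ⁻¹ * τ) := by rw [← h]; group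

theorem follows_cyclicSucc {n : ℕ} (σ : Equiv.Perm (Fin (n + 1))) {a : Fin (n + 1)}
    (ha : a ≠ σ (Fin.last n)) (b : Fin (n + 1)) :
    Follows (word σ) a b ↔ cyclicSucc σ a = b := by
  obtain ⟨i, rfl⟩ := σ.surjective a
  have hi : i ≠ Fin.last n := fun h => ha (by rw [h])
  rw [follows_word, cyclicSucc_apply]
  have hv := coe_finRotate_of_ne_last hi
  constructor
  · rintro ⟨i', j, h, h1, rfl⟩
    rw [σ.injective h1] at h
    congr 1
    exact Fin.ext (by omega)
  · rintro rfl
    exact ⟨i, _, hv.symm, rfl, rfl⟩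

theorem not_follows_last {n : ℕ} (σ : Equiv.Perm (Fin (n + 1))) (b : Fin (n + 1)) :
    ¬ Follows (word σ) (σ (Fin.last n)) b := by
  rw [follows_word]
  rintro ⟨i', j, h, h1, rfl⟩
  rw [σ.injective h1, Fin.val_last] at h
  omega

end Cyclic

/-! ### Logarithmic derivatives modulo f -/

section LogDerivative

variable {F ι : Type*} [Field F] [DecidableEq ι]

/-- The logarithmic derivative with denominators cleared. -/
theorem derivative_prod_X_sub_C_pow_mul (s : Finset ι) (α : ι → F) (e : ι → ℕ) :
    derivative (∏ a ∈ s, (X - C (α a)) ^ e a) * ∏ a ∈ s, (X - C (α a)) =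
      (∏ a ∈ s, (X - C (α a)) ^ e a) *
        ∑ a ∈ s, C (e a : F) * ∏ b ∈ s.erase a, (X - C (α b)) := by
  rw [derivative_prod_finset, Finset.sum_mul, Finset.mul_sum]
  refine Finset.sum_congr rfl fun a ha => ?_
  rw [← Finset.mul_prod_erase s (fun a => (X - C (α a)) ^ e a) ha,
    ← Finset.mul_prod_erase s (fun a => X - C (α a)) ha, derivative_X_sub_C_pow]
  rcases Nat.eq_zero_or_pos (e a) with h | h
  · simp [h]
  · obtain ⟨k, hk⟩ := Nat.exists_eq_succ_of_ne_zero h.ne'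
    rw [hk, Nat.succ_sub_one, Nat.succ_eq_add_one]
    simp only [map_natCast]
    ring

/-- Differentiating a congruence mod f² leaves one mod f, and H^p behaves like a constant.
Cross-multiplying the two congruences eliminates H^p, and P and Q cancel because f is coprime to
them. -/
theorem dvd_sum_of_sq_dvd {p : ℕ} [CharP F p] {f : F[X]} (hf : Prime f) (s : Finset ι) (α : ι → F)
    (hco : ∀ a ∈ s, ¬ f ∣ X - C (α a)) (e e' : ι → ℕ) (H : F[X])
    (h : f ^ 2 ∣ (∏ a ∈ s, (X - C (α a)) ^ e a) * H ^ p - ∏ a ∈ s, (X - C (α a)) ^ e' a) :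
    f ∣ ∑ a ∈ s, C ((e a : F) - e' a) * ∏ b ∈ s.erase a, (X - C (α b)) := by
  set P := ∏ a ∈ s, (X - C (α a)) ^ e a with hP
  set Q := ∏ a ∈ s, (X - C (α a)) ^ e' a with hQ
  set W := ∏ a ∈ s, (X - C (α a)) with hW
  have hPd : derivative P * W = P * _ := derivative_prod_X_sub_C_pow_mul s α e
  have hQd : derivative Q * W = Q * _ := derivative_prod_X_sub_C_pow_mul s α e'
  have hndvd : ∀ e : ι → ℕ, ¬ f ∣ ∏ a ∈ s, (X - C (α a)) ^ e a := by
    intro e hdvd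
    obtain ⟨a, ha, hdvd⟩ := (hf.dvd_finsetProd_iff _).1 hdvd
    exact hco a ha (hf.dvd_of_dvd_pow hdvd)
  have h1 : f ∣ P * H ^ p - Q := (dvd_pow_self f two_ne_zero).trans h
  have h2 : f ∣ derivative P * H ^ p - derivative Q := by
    obtain ⟨r, hr⟩ := h
    have hd := congrArg derivative hr
    rw [derivative_sub, derivative_mul, derivative_pow, CharP.cast_eq_zero F p, C_0] at hd
    simp only [zero_mul, mul_zero, add_zero] at hd
    rw [hd, derivative_mul, derivative_pow]
    refine Dvd.intro (C 2 * derivative f * r + f * derivative r) ?_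
    simp only [Nat.cast_ofNat, Nat.add_one_sub_one]
    ring
  have h3 : f ∣ derivative P * Q - derivative Q * P := by
    have : derivative P * Q - derivative Q * P =
      P * (derivative P * H ^ p - derivative Q) - derivative P * (P * H ^ p - Q) := by ring
    rw [this]
    exact dvd_sub (h2.mul_left _) (h1.mul_left _)
  have h4 : f ∣ P * (Q * ∑ a ∈ s, C ((e a : F) - e' a) * ∏ b ∈ s.erase a, (X - C (α b))) := by
    refine (h3.mul_right W).trans (dvd_of_eq ?_)
    simp only [C_sub, sub_mul, Finset.sum_sub_distrib]
    linear_combination Q * hPd - P * hQd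
  exact ((hf.dvd_or_dvd h4).resolve_left (hndvd e) |> hf.dvd_or_dvd).resolve_left (hndvd e')

/-- The sum is nonzero, as its value at each node α_a is c_a times a nonzero product. Its
coefficient in degree |s| - 1 is Σ c_a = 0, which gains one degree over the obvious bound. -/
theorem natDegree_add_two_le_card_of_dvd_sum {f : F[X]} (s : Finset ι) (hs : s.Nonempty)
    (α : ι → F) (hα : Set.InjOn α s) (c : ι → F) (hc : ∀ a ∈ s, c a ≠ 0) (hsum : ∑ a ∈ s, c a = 0)
    (h : f ∣ ∑ a ∈ s, C (c a) * ∏ b ∈ s.erase a, (X - C (α b))) :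
    f.natDegree + 2 ≤ s.card := by
  set M := ∑ a ∈ s, C (c a) * ∏ b ∈ s.erase a, (X - C (α b)) with hM
  have heval : ∀ a ∈ s, M.eval (α a) = c a * ∏ b ∈ s.erase a, (α a - α b) := by
    intro a ha
    rw [hM, eval_finsetSum, Finset.sum_eq_single_of_mem a ha]
    · simp [eval_prod]
    · intro b _ hba
      rw [eval_mul, eval_prod, Finset.prod_eq_zero (Finset.mem_erase.2 ⟨hba.symm, ha⟩) (by simp),
        mul_zero]
  have hM0 : M ≠ 0 := by
    obtain ⟨a, ha⟩ := hs
    intro h0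
    have := heval a ha
    rw [h0, eval_zero, eq_comm, mul_eq_zero, Finset.prod_eq_zero_iff] at this
    obtain h | ⟨b, hb, hab⟩ := this
    · exact hc a ha h
    · rw [Finset.mem_erase] at hb
      exact hb.1 (hα hb.2 ha (sub_eq_zero.1 hab).symm)
  have hdeg : ∀ a ∈ s, (∏ b ∈ s.erase a, (X - C (α b))).natDegree = s.card - 1 := by
    intro a ha
    rw [natDegree_prod_of_monic _ _ fun b _ => monic_X_sub_C _]
    simp [Finset.card_erase_of_mem ha]
  have hcoeff : M.coeff (s.card - 1) = 0 := by
    rw [hM, finsetSum_coeff, ← hsum]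
    refine Finset.sum_congr rfl fun a ha => ?_
    rw [coeff_C_mul, ← hdeg a ha,
      (monic_prod_of_monic _ _ fun b _ => monic_X_sub_C (α b)).coeff_natDegree, mul_one]
  have hle : M.natDegree ≤ s.card - 1 := by
    refine natDegree_sum_le_of_forall_le _ _ fun a ha => ?_
    exact (natDegree_C_mul_le _ _).trans (hdeg a ha).le
  have hne : M.natDegree ≠ s.card - 1 := by
    intro h
    rw [← h, coeff_natDegree, leadingCoeff_eq_zero] at hcoeff
    exact hM0 hcoeff
  have := natDegree_le_of_dvd h hM0
  omega

end LogDerivative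

/-! ### Permutations with equal class, and the order of G/G^p -/

namespace LabelData

variable {n d : ℕ} (L : LabelData n d)

theorem cyclicClass_eq (σ : Equiv.Perm (Fin n)) :
    L.cyclicClass σ =
      QuotientGroup.mk (∏ a : Fin n, L.linearUnit (L.α a) ^ ((cyclicSucc σ a).val + 1)) := by
  unfold cyclicClass
  congr 1
  rw [← Equiv.prod_comp σ fun a => L.linearUnit (L.α a) ^ ((cyclicSucc σ a).val + 1)]
  simp only [cyclicSucc_apply]

theorem f_prime : Prime L.f :=
  have := Fact.mk L.prime
  L.f_irreducible.prime

theorem not_f_dvd_linear (a : ZMod L.p) : ¬ L.f ∣ X - C a := by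
  have := Fact.mk L.prime
  intro h
  have h1 := natDegree_le_of_dvd h (X_sub_C_ne_zero a)
  have := L.four_le
  rw [natDegree_X_sub_C, L.f_degree] at h1
  omega

theorem f_sq_dvd_of_cyclicClass_eq {σ τ : Equiv.Perm (Fin n)}
    (h : L.cyclicClass σ = L.cyclicClass τ) :
    ∃ H : (ZMod L.p)[X], L.f ^ 2 ∣
      (∏ a : Fin n, (X - C (L.α a)) ^ ((cyclicSucc σ a).val + 1)) * H ^ L.p -
        ∏ a : Fin n, (X - C (L.α a)) ^ ((cyclicSucc τ a).val + 1) := by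
  rw [cyclicClass_eq, cyclicClass_eq, QuotientGroup.eq] at h
  obtain ⟨u, hu⟩ := h
  rw [powMonoidHom_apply, eq_inv_mul_iff_mul_eq] at hu
  obtain ⟨H, hH⟩ := Ideal.Quotient.mk_surjective u.val
  refine ⟨H, Ideal.mem_span_singleton.1 (Ideal.Quotient.eq.1 ?_)⟩
  have hu := congrArg Units.val hu
  rw [Units.val_mul, Units.val_pow_eq_pow_val, Units.coe_prod, Units.coe_prod] at hu
  rw [map_mul, map_pow, map_prod, map_prod, hH]
  simpa [map_pow, linearUnit] using hu

theorem card_cyclicSucc_ne {σ τ : Equiv.Perm (Fin n)} (h : L.cyclicClass σ = L.cyclicClass τ)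
    (hne : cyclicSucc σ ≠ cyclicSucc τ) :
    d + 1 ≤ (Finset.univ.filter fun a => cyclicSucc σ a ≠ cyclicSucc τ a).card := by
  have := Fact.mk L.prime
  set D := Finset.univ.filter fun a => cyclicSucc σ a ≠ cyclicSucc τ a with hD
  obtain ⟨H, hH⟩ := L.f_sq_dvd_of_cyclicClass_eq h
  have h1 := dvd_sum_of_sq_dvd L.f_prime Finset.univ L.α (fun a _ => L.not_f_dvd_linear _) _ _ H hH
  set c : Fin n → ZMod L.p := fun a =>
    (((cyclicSucc σ a).val + 1 : ℕ) : ZMod L.p) - (((cyclicSucc τ a).val + 1 : ℕ) : ZMod L.p) with hc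
  have hc0 : ∀ a, c a = 0 ↔ a ∉ D := by
    intro a
    rw [hc, hD, Finset.mem_filter, sub_eq_zero, ZMod.natCast_eq_natCast_iff]
    simp only [Finset.mem_univ, true_and, not_not]
    constructor
    · intro h
      have h := Nat.ModEq.add_right_cancel' 1 h
      have hn := L.n_le
      exact Fin.ext (Nat.ModEq.eq_of_lt_of_lt h (by omega) (by omega))
    · intro h; rw [h]
  -- The terms outside D vanish, and the linear factors outside D are common to all others; being
  -- coprime to f, they can be cancelled.
  have h2 : ∑ a, C (c a) * ∏ b ∈ Finset.univ.erase a, (X - C (L.α b)) =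
      (∏ b ∈ Dᶜ, (X - C (L.α b))) * ∑ a ∈ D, C (c a) * ∏ b ∈ D.erase a, (X - C (L.α b)) := by
    rw [← Finset.sum_subset (Finset.subset_univ D)
      (fun a _ ha => by rw [(hc0 a).2 ha, C_0, zero_mul]), Finset.mul_sum]
    refine Finset.sum_congr rfl fun a ha => ?_
    have : Finset.univ.erase a = Dᶜ ∪ D.erase a := by
      ext b
      simp only [Finset.mem_erase, Finset.mem_univ, and_true, Finset.mem_union, Finset.mem_compl]
      refine ⟨fun h => ?_, ?_⟩
      · by_cases hb : b ∈ D <;> simp [hb, h]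
      · rintro (h | h)
        · rintro rfl; exact h ha
        · exact h.1
    rw [this, Finset.prod_union]
    · ring
    · exact disjoint_compl_left.mono_right (Finset.erase_subset _ _)
  rw [h2] at h1
  have h3 := (L.f_prime.dvd_or_dvd h1).resolve_left (by
    rw [L.f_prime.dvd_finsetProd_iff]
    rintro ⟨a, -, ha⟩
    exact L.not_f_dvd_linear _ ha)
  have h4 := natDegree_add_two_le_card_of_dvd_sum D ?_ L.α L.α_injective.injOn c
    (fun a ha h => (hc0 a).1 h ha) ?_ h3
  · have := L.four_le
    rw [L.f_degree] at h4
    omega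
  · obtain ⟨a, ha⟩ := not_forall.1 fun h => hne (Equiv.ext h)
    exact ⟨a, by simpa [hD] using ha⟩
  -- The coefficients sum to zero because both successor maps permute the same set of symbols.
  · rw [Finset.sum_subset (Finset.subset_univ D) fun a _ ha => (hc0 a).2 ha]
    rw [hc, Finset.sum_sub_distrib, sub_eq_zero,
      Equiv.sum_comp (cyclicSucc σ) fun b : Fin n => ((b.val + 1 : ℕ) : ZMod L.p),
      Equiv.sum_comp (cyclicSucc τ) fun b : Fin n => ((b.val + 1 : ℕ) : ZMod L.p)]

/-- Frobenius is surjective on the finite field F_p[x]/(f), so g agrees mod f with a p-th power, and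
the quotient is 1 mod f. -/
theorem exists_pow_mul_eq (g : L.Rˣ) :
    ∃ (u v : L.Rˣ) (r : (ZMod L.p)[X]), r.degree < ((d - 1 : ℕ) : WithBot ℕ) ∧
      v.val = Ideal.Quotient.mk _ (1 + L.f * r) ∧ g = u ^ L.p * v := by
  have := Fact.mk L.prime
  have := Fact.mk L.f_irreducible
  have h4 := L.four_le
  have : Module.Finite (ZMod L.p) (AdjoinRoot L.f) :=
    (AdjoinRoot.powerBasis L.f_irreducible.ne_zero).finite
  have : Finite (AdjoinRoot L.f) := Module.finite_of_finite (ZMod L.p)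
  have : CharP (AdjoinRoot L.f) L.p := charP_of_injective_algebraMap
    (algebraMap (ZMod L.p) (AdjoinRoot L.f)).injective L.p
  obtain ⟨P, hP⟩ := Ideal.Quotient.mk_surjective g.val
  obtain ⟨y, hy⟩ := surjective_frobenius (AdjoinRoot L.f) L.p (AdjoinRoot.mk L.f P)
  obtain ⟨H, rfl⟩ := AdjoinRoot.mk_surjective y
  rw [frobenius_def, ← map_pow, AdjoinRoot.mk_eq_mk] at hy
  have hPunit : IsCoprime P (L.f ^ 2) := by
    obtain ⟨Q, hQ⟩ := Ideal.Quotient.mk_surjective (g⁻¹).val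
    have : Ideal.Quotient.mk (Ideal.span {L.f ^ 2}) (Q * P) = Ideal.Quotient.mk _ 1 := by
      rw [map_mul, hP, hQ, map_one, Units.inv_mul]
    rw [Ideal.Quotient.eq, Ideal.mem_span_singleton] at this
    obtain ⟨t, ht⟩ := this
    exact ⟨Q, -t, by linear_combination ht⟩
  have hPf : IsCoprime P L.f := hPunit.of_isCoprime_of_dvd_right (dvd_pow_self _ two_ne_zero)
  have hHf : IsCoprime H L.f := by
    rw [isCoprime_comm, L.f_irreducible.coprime_iff_not_dvd]
    intro h
    have h1 : L.f ∣ P := by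
      have := dvd_sub (h.trans (dvd_pow_self H L.prime.ne_zero)) hy
      simpa using this
    exact L.f_irreducible.not_isUnit (hPf.isUnit_of_dvd' h1 dvd_rfl)
  obtain ⟨A, B, hAB⟩ := hHf.pow_right (n := 2)
  have hz : Ideal.Quotient.mk (Ideal.span {L.f ^ 2}) (L.f ^ 2) = 0 :=
    Ideal.Quotient.eq_zero_iff_mem.2 (Ideal.mem_span_singleton_self _)
  have hAH : Ideal.Quotient.mk (Ideal.span {L.f ^ 2}) A *
      Ideal.Quotient.mk (Ideal.span {L.f ^ 2}) H = 1 := by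
    have := congrArg (Ideal.Quotient.mk (Ideal.span {L.f ^ 2})) hAB
    rwa [map_add, map_mul, map_mul, hz, mul_zero, add_zero, map_one] at this
  let u : L.Rˣ := ⟨Ideal.Quotient.mk _ H, Ideal.Quotient.mk _ A, by rw [mul_comm, hAH], hAH⟩
  obtain ⟨q, hq⟩ := hy
  -- Here P = H^p - f q, and A inverts H mod f². Hence P A^p ≡ 1 - f q A^p, where the cofactor of f
  -- matters only mod f.
  refine ⟨u, (u ^ L.p)⁻¹ * g, (-q * A ^ L.p) % L.f, ?_, ?_, by group⟩
  · refine (EuclideanDomain.mod_lt _ L.f_irreducible.ne_zero).trans_eq ?_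
    rw [degree_eq_natDegree L.f_irreducible.ne_zero, L.f_degree]
  · have hmod : Ideal.Quotient.mk (Ideal.span {L.f ^ 2}) (1 + L.f * ((-q * A ^ L.p) % L.f)) =
        Ideal.Quotient.mk _ (1 + L.f * (-q * A ^ L.p)) := by
      rw [Ideal.Quotient.eq, Ideal.mem_span_singleton]
      refine ⟨-((-q * A ^ L.p) / L.f), ?_⟩
      have := EuclideanDomain.div_add_mod (-q * A ^ L.p) L.f
      linear_combination L.f * this
    have hinv : ((u ^ L.p)⁻¹).val = Ideal.Quotient.mk _ (A ^ L.p) := by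
      rw [← inv_pow, Units.val_pow_eq_pow_val, map_pow]
      rfl
    have hAHp := congrArg (· ^ L.p) hAH
    simp only [mul_pow, one_pow, ← map_pow] at hAHp
    rw [hmod, Units.val_mul, hinv, ← hP]
    have hPe : P = H ^ L.p - L.f * q := by linear_combination -hq
    rw [hPe, map_sub, mul_sub, hAHp, map_add, map_one]
    simp only [map_mul, map_neg, map_pow]
    ring

/-- A class is determined by the d - 1 coefficients of the remainder r in `exists_pow_mul_eq`. -/
theorem card_gModPow_le : Finite L.GModPow ∧ Nat.card L.GModPow ≤ L.p ^ (d - 1) := by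
  have := Fact.mk L.prime
  have h : ∀ g : L.GModPow, ∃ c : Fin (d - 1) → ZMod L.p, ∃ v : L.Rˣ,
      v.val = Ideal.Quotient.mk _ (1 + L.f * ((degreeLTEquiv _ _).symm c).val) ∧
        g = QuotientGroup.mk v := by
    intro g
    obtain ⟨g, rfl⟩ := QuotientGroup.mk_surjective g
    obtain ⟨u, v, r, hr, hv, rfl⟩ := L.exists_pow_mul_eq g
    refine ⟨degreeLTEquiv _ _ ⟨r, mem_degreeLT.2 hr⟩, v, by simpa using hv, ?_⟩
    rw [eq_comm, QuotientGroup.eq]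
    exact ⟨u, by rw [mul_comm (u ^ L.p), inv_mul_cancel_left]; rfl⟩
  choose c v hv hg using h
  have hinj : Function.Injective c := by
    intro g g' hgg
    rw [hg g, hg g']
    congr 1
    apply Units.ext
    rw [hv, hv, hgg]
  refine ⟨Finite.of_injective c hinj, ?_⟩
  have := Nat.card_le_card_of_injective c hinj
  simpa [Nat.card_eq_fintype_card, ZMod.card] using this

end LabelData

/-! ### Translates of the Reed–Solomon code -/

section ReedSolomon

theorem natCast_val_injective {n p : ℕ} (hn : n ≤ p) :
    Function.Injective fun a : Fin n => (a.val : ZMod p) := by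
  intro a b h
  have h := (ZMod.natCast_eq_natCast_iff _ _ _).1 h
  exact Fin.ext (Nat.ModEq.eq_of_lt_of_lt h (by omega) (by omega))

/-- The minimum distance of a Reed–Solomon code: a nonzero polynomial of degree less than `k` is
nonzero at at least `K - k + 1` of the points `0, …, K - 1`. -/
theorem card_eval_ne_zero {p : ℕ} [Fact p.Prime] {K k : ℕ} (hK : K ≤ p) {g : (ZMod p)[X]}
    (hg : g ≠ 0) (hdeg : g.degree < (k : WithBot ℕ)) :
    K + 1 ≤ k + (Finset.univ.filter fun m : Fin K => g.eval (m.val : ZMod p) ≠ 0).card := by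
  have h1 : (Finset.univ.filter fun m : Fin K => g.eval (m.val : ZMod p) = 0).card ≤
      g.natDegree := by
    rw [← Finset.card_image_of_injective _ (natCast_val_injective hK)]
    refine card_le_degree_of_subset_roots fun x hx => ?_
    rw [Finset.mem_val, Finset.mem_image] at hx
    obtain ⟨m, hm, rfl⟩ := hx
    rw [Finset.mem_filter] at hm
    exact (mem_roots hg).2 hm.2
  have h2 := (natDegree_lt_iff_degree_lt hg).2 hdeg
  have h3 := Finset.card_filter_add_card_filter_not (s := (Finset.univ : Finset (Fin K)))
    (fun m => g.eval (m.val : ZMod p) = 0)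
  rw [Finset.card_univ, Fintype.card_fin] at h3
  simp only [ne_eq]
  omega

theorem card_ne_of_mem_rsWords {n d p : ℕ} [Fact p.Prime] (hn : n ≤ p) (hK : 3 * d - 1 ≤ p)
    {β : Fin (3 * d - 1) → ZMod p} {S T : Fin (3 * d - 1) → Fin n} (hS : S ∈ rsWords n d p β)
    (hT : T ∈ rsWords n d p β) (hne : S ≠ T) :
    d ≤ (Finset.univ.filter fun m => S m ≠ T m).card := by
  obtain ⟨-, g, hg, hSg⟩ := hS
  obtain ⟨-, g', hg', hTg⟩ := hT
  have hiff : ∀ m, S m ≠ T m ↔ (g - g').eval (m.val : ZMod p) ≠ 0 := by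
    intro m
    rw [not_iff_not, eval_sub, sub_eq_zero]
    refine (natCast_val_injective hn).eq_iff.symm.trans ?_
    simp only [hSg, hTg, add_left_inj]
  have h0 : g - g' ≠ 0 := by
    obtain ⟨m, hm⟩ := Function.ne_iff.1 hne
    intro h
    rw [hiff, h, eval_zero] at hm
    exact hm rfl
  have h1 := card_eval_ne_zero hK h0 ((degree_sub_le _ _).trans_lt (max_lt hg hg'))
  simp only [hiff]
  omega

/-- Pigeonhole: the pairs (S, g) of an injective word and a polynomial are distributed among the
p^(3d-1) possible differences S - g. -/
theorem exists_card_rsWords_ge {n d p M : ℕ} [Fact p.Prime] (hK : 3 * d - 1 ≤ p)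
    (hd : 1 ≤ d) (h : p ^ (3 * d - 1) * M ≤ n.descFactorial (3 * d - 1) * p ^ (2 * d)) :
    ∃ β : Fin (3 * d - 1) → ZMod p, M ≤ Nat.card (rsWords n d p β) := by
  classical
  let ev : (Fin (3 * d - 1) ↪ Fin n) × (Fin (2 * d) → ZMod p) → Fin (3 * d - 1) → ZMod p :=
    fun x m => ((x.1 m).val : ZMod p) -
      ((degreeLTEquiv (ZMod p) (2 * d)).symm x.2).val.eval (m.val : ZMod p)
  obtain ⟨β, -, hβ⟩ := Finset.exists_le_card_fiber_of_mul_le_card_of_maps_to (f := ev) (n := M)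
    (s := Finset.univ) (t := Finset.univ) (fun _ _ => Finset.mem_univ _) Finset.univ_nonempty
    (by simpa [Finset.card_univ, Fintype.card_embedding_eq, ZMod.card] using h)
  refine ⟨β, hβ.trans ?_⟩
  rw [← Fintype.card_coe, ← Nat.card_eq_fintype_card]
  have hx : ∀ x : {x // x ∈ Finset.univ.filter fun x => ev x = β}, ∀ m,
      ((x.1.1 m).val : ZMod p) =
        ((degreeLTEquiv (ZMod p) (2 * d)).symm x.1.2).val.eval (m.val : ZMod p) + β m := by
    intro x m
    have := congrFun (Finset.mem_filter.1 x.2).2 m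
    rw [← this]
    simp [ev]
  refine Nat.card_le_card_of_injective
    (fun x : {x // x ∈ Finset.univ.filter fun x => ev x = β} =>
      (⟨x.1.1, x.1.1.injective, _, mem_degreeLT.1 (Subtype.prop _), hx x⟩ : rsWords n d p β)) ?_
  intro x y hxy
  have h1 : x.1.1 = y.1.1 := DFunLike.coe_injective (Subtype.mk.inj hxy)
  refine Subtype.ext (Prod.ext h1 ?_)
  apply (degreeLTEquiv (ZMod p) (2 * d)).symm.injective
  -- Within a fibre S determines g: two polynomials of degree below 2d that agree at all 3d - 1
  -- points coincide.
  refine Subtype.ext (sub_eq_zero.1 (by_contra fun h0 => ?_))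
  have h2 := card_eval_ne_zero hK h0 ((degree_sub_le _ _).trans_lt
    (max_lt (mem_degreeLT.1 (Subtype.prop _)) (mem_degreeLT.1 (Subtype.prop _))))
  rw [Finset.filter_false_of_mem, Finset.card_empty] at h2
  · omega
  · intro m _
    have h3 := hx x m
    rw [h1, hx y m, add_left_inj] at h3
    rw [eval_sub, not_not, sub_eq_zero, h3]

end ReedSolomon

/-! ### Counting and existence of the choices -/

theorem mul_pow_le_descFactorial {n d p : ℕ} (hd : 4 ≤ d) (hn : 6 * d + 2 ≤ n) (hp : p < 2 * n) :
    n * p ^ (2 * d - 2) ≤ n.descFactorial (3 * d - 1) := by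
  obtain ⟨n, rfl⟩ := Nat.exists_eq_succ_of_ne_zero (by omega : n ≠ 0)
  rw [show 3 * d - 1 = (3 * d - 2) + 1 by omega, Nat.succ_descFactorial_succ]
  refine Nat.mul_le_mul_left _ (le_trans ?_ (Nat.pow_sub_le_descFactorial _ _))
  set m := n + 1 - (3 * d - 2) with hm
  -- From n + 1 ≥ 6d + 2 it follows that n + 1 ≤ 2m, so p ≤ 4m, and that m ≥ 3d + 4 ≥ 16, so 16 is
  -- absorbed into m.
  calc p ^ (2 * d - 2) ≤ (4 * m) ^ (2 * d - 2) := Nat.pow_le_pow_left (by omega) _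
    _ = 16 ^ (d - 1) * m ^ (2 * d - 2) := by
      rw [mul_pow, show 2 * d - 2 = 2 * (d - 1) by omega, pow_mul 4]
      norm_num
    _ ≤ m ^ (d - 1) * m ^ (2 * d - 2) :=
      Nat.mul_le_mul_right _ (Nat.pow_le_pow_left (by omega) _)
    _ = m ^ (3 * d - 3) := by rw [← pow_add]; congr 1; omega
    _ ≤ m ^ (3 * d - 2) := Nat.pow_le_pow_right (by omega) (by omega)

theorem exists_irreducible_natDegree_eq (p : ℕ) [Fact p.Prime] {k : ℕ} (hk : k ≠ 0) :
    ∃ f : (ZMod p)[X], Irreducible f ∧ f.natDegree = k := by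
  obtain ⟨a, ha⟩ := Field.exists_primitive_element (ZMod p) (GaloisField p k)
  refine ⟨minpoly (ZMod p) a, minpoly.irreducible (Algebra.IsIntegral.isIntegral a), ?_⟩
  rw [(Field.primitive_element_iff_minpoly_natDegree_eq _ _).1 ha, GaloisField.finrank p hk]

theorem apply_zero_separates {n : ℕ} {σ τ : Equiv.Perm (Fin (n + 1))}
    (h : (QuotientGroup.mk σ : Equiv.Perm (Fin (n + 1)) ⧸ Subgroup.zpowers (finRotate (n + 1))) =
      QuotientGroup.mk τ) (h0 : σ 0 = τ 0) : σ = τ := by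
  rw [QuotientGroup.eq] at h
  obtain ⟨k, hk⟩ := Subgroup.mem_zpowers_iff.1 h
  refine inv_mul_eq_one.1 (eq_one_of_commute_finRotate ?_ ?_)
  · rw [← hk]; exact (Commute.refl _).zpow_left k
  · rw [Equiv.Perm.mul_apply, Equiv.Perm.inv_eq_iff_eq, h0]

theorem nonempty_labelData {n d : ℕ} (hd : 4 ≤ d) (hn : 1 ≤ n) :
    Nonempty (LabelData (n + 1) d) := by
  -- Bertrand's postulate for n: n < p ≤ 2n gives n + 1 ≤ p < 2(n + 1).
  obtain ⟨p, hp, h1, h2⟩ := Nat.exists_prime_lt_and_le_two_mul n (by omega)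
  have := Fact.mk hp
  obtain ⟨f, hf, hfd⟩ := exists_irreducible_natDegree_eq p (k := d - 1) (by omega)
  exact ⟨{ four_le := hd, p := p, prime := hp, n_le := h1, p_lt := by omega
           α := fun a => (a.val : ZMod p), α_injective := natCast_val_injective h1
           f := f, f_irreducible := hf, f_degree := hfd
           s := fun σ => σ 0, s_separates := fun σ τ => apply_zero_separates }⟩

namespace LabelData

variable {n d : ℕ} (L : LabelData n d)

theorem exists_injective_rsWords (hn : 6 * d + 2 ≤ n) :
    ∃ β : Fin (3 * d - 1) → ZMod L.p, ∃ ψ : L.Label → Fin (3 * d - 1) → Fin n,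
      Function.Injective ψ ∧ ∀ l, ψ l ∈ rsWords n d L.p β := by
  have := Fact.mk L.prime
  have hd := L.four_le
  have hnp := L.n_le
  obtain ⟨β, hβ⟩ := exists_card_rsWords_ge (n := n) (d := d) (p := L.p) (M := L.p ^ (d - 1) * n)
    (by omega) (by omega) (by
      calc L.p ^ (3 * d - 1) * (L.p ^ (d - 1) * n)
          = n * L.p ^ (2 * d - 2) * L.p ^ (2 * d) := by
            rw [mul_assoc, ← pow_add, ← mul_assoc, ← pow_add, mul_comm]
            congr 2; omega
        _ ≤ _ := Nat.mul_le_mul_right _ (mul_pow_le_descFactorial hd hn L.p_lt))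
  obtain ⟨hfin, hcard⟩ := L.card_gModPow_le
  have := Fintype.ofFinite L.Label
  have := Fintype.ofFinite (rsWords n d L.p β)
  have hle : Nat.card L.Label ≤ Nat.card (rsWords n d L.p β) := by
    refine le_trans ?_ hβ
    rw [Nat.card_prod, Nat.card_fin]
    exact Nat.mul_le_mul_right _ hcard
  rw [Nat.card_eq_fintype_card, Nat.card_eq_fintype_card] at hle
  obtain ⟨ψ⟩ := Function.Embedding.nonempty_of_card_le hle
  exact ⟨β, fun l => (ψ l).val, Subtype.val_injective.comp ψ.injective, fun l => (ψ l).2⟩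

end LabelData

/-! ### Distance between two extensions -/

/-- The predecessor of `n + m` in `extend σ S` is `S m`, so every disagreement of S and T shows up
as a separate pair. -/
theorem card_ne_le_blockDist {n K N : ℕ} (hN : N = n + K)
    {π π' : Equiv.Perm (Fin N)} {σ τ : Equiv.Perm (Fin n)} {S T : Fin K → Fin n}
    (hS : Function.Injective S) (hT : Function.Injective T) (hπ : word π = extend σ S)
    (hπ' : word π' = extend τ T) :
    (Finset.univ.filter fun m => S m ≠ T m).card ≤ blockDist π π' := by
  subst hN
  refine Finset.card_le_card_of_injOn
    (fun m => (Fin.castAdd K (S m), Fin.natAdd n m)) ?_ ?_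
  · intro m hm
    have hm : S m ≠ T m := (Finset.mem_filter.1 hm).2
    rw [Finset.mem_coe, Finset.mem_sdiff, mem_charSet, mem_charSet, hπ, hπ', follows_extend σ hS,
      follows_extend τ hT]
    refine ⟨Or.inl ⟨m, by simp⟩, ?_⟩
    have hword : ∀ a, ¬ Follows (word τ) a (n + m.val) := fun a h => by
      have := (word_perm τ).mem_iff.1 h.mem.2
      simp at this
    rintro (⟨k, h1, h2⟩ | ⟨k, -, h2⟩ | ⟨-, h2⟩)
    · have hk : m = k := Fin.ext (by simpa using h2)
      exact hm (Fin.ext (by simpa [← hk] using h1))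
    · exact hword _ h2
    · exact hword _ h2
  · intro m _ k _ h
    exact Fin.natAdd_injective _ _ (Prod.ext_iff.1 h).2

/-- A pair (a, b) of `word σ` survives the insertions as (a, b), or as (n + m, b) if a = `S m`; the
shared `S` makes the rule the same for τ. Only the last symbol of σ is lost, since its cyclic
successor does not follow it in the word. -/
theorem card_cyclicSucc_ne_le_blockDist {n K N : ℕ} (hN : N = n + 1 + K)
    {π π' : Equiv.Perm (Fin N)} {σ τ : Equiv.Perm (Fin (n + 1))} {S : Fin K → Fin (n + 1)}
    (hS : Function.Injective S) (hπ : word π = extend σ S) (hπ' : word π' = extend τ S) :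
    (Finset.univ.filter fun a => cyclicSucc σ a ≠ cyclicSucc τ a).card ≤ blockDist π π' + 1 := by
  classical
  subst hN
  set D := Finset.univ.filter fun a => cyclicSucc σ a ≠ cyclicSucc τ a with hD
  have hcard : D.card ≤ (D.erase (σ (Fin.last n))).card + 1 := by
    have := Finset.pred_card_le_card_erase (s := D) (a := σ (Fin.last n))
    omega
  refine hcard.trans (Nat.add_le_add_right ?_ 1)
  -- The second component alone gives injectivity, as the successor map is a permutation.
  refine Finset.card_le_card_of_injOn
    (fun a => ((if h : ∃ m, S m = a then Fin.natAdd (n + 1) h.choose else Fin.castAdd K a),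
      Fin.castAdd K (cyclicSucc σ a))) ?_ ?_
  · intro a ha
    obtain ⟨ha1, ha2⟩ := Finset.mem_erase.1 (Finset.mem_coe.1 ha)
    rw [hD, Finset.mem_filter] at ha2
    have hσ : Follows (word σ) a (cyclicSucc σ a) := (follows_cyclicSucc σ ha1 _).2 rfl
    have hτ : ¬ Follows (word τ) a (cyclicSucc σ a) := by
      by_cases h : a = τ (Fin.last n)
      · rw [h]; exact not_follows_last τ _
      · rw [follows_cyclicSucc τ h]; exact fun h => ha2.2 h.symm
    rw [Finset.mem_coe, Finset.mem_sdiff, mem_charSet, mem_charSet, hπ, hπ', follows_extend σ hS,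
      follows_extend τ hS]
    have hlt : ∀ b : Fin (n + 1), b.val < n + 1 := fun b => b.isLt
    split_ifs with h
    · have hm := h.choose_spec
      generalize h.choose = m at hm ⊢
      subst hm
      refine ⟨Or.inr (Or.inl ⟨m, by simp, hσ⟩), ?_⟩
      rintro (⟨k, h1, -⟩ | ⟨k, h1, h2⟩ | ⟨-, h2⟩)
      · have := hlt (S k)
        simp at h1
        omega
      · have hk : m = k := Fin.ext (by simpa using h1)
        rw [← hk] at h2
        exact hτ h2
      · have := (word_perm τ).mem_iff.1 h2.mem.1
        simp at this
        omega
    · refine ⟨Or.inr (Or.inr ⟨fun m hm => h ⟨m, Fin.ext (by simpa using hm.symm)⟩, hσ⟩), ?_⟩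
      rintro (⟨k, h1, -⟩ | ⟨k, h1, -⟩ | ⟨-, h2⟩)
      · exact h ⟨k, Fin.ext (by simpa using h1.symm)⟩
      · have := hlt a
        simp at h1
        omega
      · exact hτ h2
  · intro a _ b _ h
    exact (cyclicSucc σ).injective (Fin.castAdd_injective _ _ (Prod.ext_iff.1 h).2)

/-! ### The code: systematic, of size n!, with distance d -/

namespace LabelData

theorem exists_word_eq_extend {n d K N : ℕ} (L : LabelData n d) (hN : N = n + K)
    (ψ : L.Label → Fin K → Fin n) (σ : Equiv.Perm (Fin n)) :
    ∃ π : Equiv.Perm (Fin N), word π = extend σ (ψ (L.label σ)) := by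
  subst hN
  exact exists_word_eq (extend_perm σ _)

theorem isSystematic_code {n d K N : ℕ} (L : LabelData n d) (hN : N = n + K)
    (ψ : L.Label → Fin K → Fin n) : IsSystematic n (L.code N ψ) := by
  refine ⟨by omega, fun σ => ?_⟩
  obtain ⟨π, hπ⟩ := L.exists_word_eq_extend hN ψ σ
  refine ⟨π, ⟨⟨σ, hπ⟩, by rw [hπ, filter_extend]⟩, ?_⟩
  rintro π' ⟨⟨σ', hσ'⟩, h⟩
  rw [hσ', filter_extend] at h
  obtain rfl := word_injective h
  exact word_injective (hσ'.trans hπ.symm)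

theorem ncard_code {n d K N : ℕ} (L : LabelData n d) (hN : N = n + K)
    (ψ : L.Label → Fin K → Fin n) : (L.code N ψ).ncard = n.factorial := by
  choose E hE using L.exists_word_eq_extend hN ψ
  have hinj : Function.Injective E := by
    intro σ τ h
    apply word_injective
    rw [← filter_extend σ (ψ (L.label σ)), ← filter_extend τ (ψ (L.label τ)), ← hE, ← hE, h]
  have hrange : L.code N ψ = Set.range E := by
    ext π
    constructor
    · rintro ⟨σ, hσ⟩; exact ⟨σ, word_injective ((hE σ).trans hσ.symm)⟩
    · rintro ⟨σ, rfl⟩; exact ⟨σ, hE σ⟩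
  rw [hrange, ← Set.image_univ, Set.ncard_image_of_injective _ hinj, Set.ncard_univ,
    Nat.card_eq_fintype_card, Fintype.card_perm, Fintype.card_fin]

theorem hasDistance_code {n d N : ℕ} (L : LabelData (n + 1) d) (hN : N = n + 1 + (3 * d - 1))
    (hK : 3 * d - 1 ≤ n + 1) {β : Fin (3 * d - 1) → ZMod L.p}
    {ψ : L.Label → Fin (3 * d - 1) → Fin (n + 1)} (hψ : Function.Injective ψ)
    (hmem : ∀ l, ψ l ∈ rsWords (n + 1) d L.p β) : HasDistance (L.code N ψ) d := by
  have := Fact.mk L.prime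
  have hnp := L.n_le
  rintro π ⟨σ, hσ⟩ π' ⟨τ, hτ⟩ hne
  by_cases hl : L.label σ = L.label τ
  · rw [← hl] at hτ
    have h1 : L.cyclicClass σ = L.cyclicClass τ := (Prod.ext_iff.1 hl).1
    have h2 : L.s σ = L.s τ := (Prod.ext_iff.1 hl).2
    have h3 : cyclicSucc σ ≠ cyclicSucc τ := by
      intro h
      obtain rfl := L.s_separates _ _ (mk_eq_of_cyclicSucc_eq h) h2
      exact hne (word_injective (hσ.trans hτ.symm))
    -- The d + 1 differing successors include one to spare for the wrap-around pair.
    have h4 := L.card_cyclicSucc_ne h1 h3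
    have h5 := card_cyclicSucc_ne_le_blockDist hN (hmem _).1 hσ hτ
    omega
  · exact (card_ne_of_mem_rsWords hnp (hK.trans hnp) (hmem _) (hmem _) (hψ.ne hl)).trans
      (card_ne_le_blockDist hN (hmem _).1 (hmem _).1 hσ hτ)

end LabelData
end BlockPerm

open BlockPerm
theorem corollary4 (N d : ℕ) (hN : 37 ≤ N) (hd : 4 ≤ d) (hNd : 9 * d + 1 ≤ N) :
    Nonempty (LabelData (N - 3 * d + 1) d) ∧
    ∀ L : LabelData (N - 3 * d + 1) d,
      (∃ β : Fin (3 * d - 1) → ZMod L.p,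
        ∃ ψ : L.Label → Fin (3 * d - 1) → Fin (N - 3 * d + 1),
          Function.Injective ψ ∧ ∀ l, ψ l ∈ rsWords (N - 3 * d + 1) d L.p β) ∧
      ∀ β : Fin (3 * d - 1) → ZMod L.p,
      ∀ ψ : L.Label → Fin (3 * d - 1) → Fin (N - 3 * d + 1),
        Function.Injective ψ → (∀ l, ψ l ∈ rsWords (N - 3 * d + 1) d L.p β) →
          IsSystematic (N - 3 * d + 1) (L.code N ψ) ∧
          HasDistance (L.code N ψ) d ∧
          (L.code N ψ).ncard = (N - 3 * d + 1).factorial := by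
  have hNK : N = N - 3 * d + 1 + (3 * d - 1) := by omega
  -- With n = N - 3d + 1, the bound 9d + 1 ≤ N becomes the 6d + 2 ≤ n needed by the counting
  -- argument.
  refine ⟨nonempty_labelData hd (by omega), fun L =>
    ⟨L.exists_injective_rsWords (by omega), fun β ψ hψ hmem =>
      ⟨L.isSystematic_code hNK ψ, L.hasDistance_code hNK (by omega) hψ hmem, L.ncard_code hNK ψ⟩⟩⟩
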